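/- For integers $m,n$ put $D_{m,n}=4m^3-27n^2$. For each fixed odd integer $n$ there are infinitely many integers $m$ such that $D_{m,n}$ is squarefree, and there are infinitely many distinct squarefree fundamental discriminants of the form $D_{m,n}$ with $m\in\mathbb{Z}$. Consequently the family of all squarefree fundamental discriminants of the form $D=4m^3-27n^2$ with $m,n\in\mathbb{Z}$ is infinite. (A fundamental discriminant is the discriminant of a quadratic number field: an integer $D$ such that either $D\equiv 1\pmod 4$, $D\neq 1$ and $D$ is squarefree, or $D=4k$ with $k\equiv 2,3\pmod 4$ squarefree.) -/

import Mathlib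

/-- The integer `D_{m,n} = 4 m ^ 3 - 27 n ^ 2`
(the discriminant of the cubic polynomial `x ^ 3 - m x + n`). -/
def cubicDisc (m n : ℤ) : ℤ := 4 * m ^ 3 - 27 * n ^ 2

/-- Fundamental discriminants, i.e. discriminants of quadratic number fields: either
`D ≡ 1 mod 4` is squarefree and `D ≠ 1`, or `D = 4 k` with `k ≡ 2, 3 mod 4` squarefree. -/
def IsFundamentalDiscriminant (D : ℤ) : Prop :=
  (D % 4 = 1 ∧ Squarefree D ∧ D ≠ 1) ∨
    ∃ k : ℤ, D = 4 * k ∧ (k % 4 = 2 ∨ k % 4 = 3) ∧ Squarefree k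

/-- The squarefree (fundamental) discriminants of the form `4 m ^ 3 - 27 n ^ 2`, for fixed `n`. -/
def squarefreeDiscriminantsOf (n : ℤ) : Set ℤ :=
  {D : ℤ | Squarefree D ∧ IsFundamentalDiscriminant D ∧ ∃ m : ℤ, D = cubicDisc m n}

/-- The squarefree (fundamental) discriminants of the form `4 m ^ 3 - 27 n ^ 2`, with
`m` and `n` arbitrary integers. -/
def squarefreeDiscriminants : Set ℤ :=
  {D : ℤ | Squarefree D ∧ IsFundamentalDiscriminant D ∧ ∃ m n : ℤ, D = cubicDisc m n}

/-! With `b = 27 * n ^ 2` odd, the task is to find arbitrarily large `m` with `f(m) = 4 * m ^ 3 - b`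
squarefree. Let `m` run through a progression of modulus `W`, the product of all primes up to `z`,
on which no prime up to `z` divides `f(m)` (`exists_base_point`). For `z < p ≤ H * X`, Hensel
uniqueness leaves at most three classes modulo `p ^ 2`, and summing over `p` costs `3N/z + 3π(H *
X)`, a small fraction of the `N` candidates (`card_exists_sq_dvd_le`).

What is left is divisibility by `p ^ 2` with `p > H * X`. Since `f(m)` has size about `X ^ 3`, it is
then `k * y ^ 2` with `k` squarefree and `k ≤ X / 2 ^ J` (`exists_squarefree_mul_sq`). Such `m` are
rare, by two estimates combined in `card_squarefree_mul_sq_le`. The pairs of a squarefree `k ≤ K`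
and a root of `f` modulo `k` number `O(K)`, with no logarithm lost: each pair is encoded by a short
vector of the lattice attached to the root (`exists_card_roots_le`). For a fixed pair, writing `m =
a + k * t` with `t < 2 ^ (j + 1)`, a sieve by primes `l ≡ 2 mod 3`, modulo which `f(a + k * t) / k`
permutes the residues, shows that it is a square for at most `s j * 2 ^ j` values of `t`, with `s`
summable (`exists_summable_sieve_bound`). The dyadic range `k ≈ X / 2 ^ j` thus contributes `O(X * s
j)`, and the tail over `j ≥ J` is as small as desired. -/

/-! ### Counting roots of the cubic to squarefree moduli. -/

/-- The norm form of the order generated by a root of `4 * u ^ 3 = b`, scaled to be integral: it is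
the resultant of `4 * u ^ 3 - b` and `x + y * u + z * u ^ 2`. -/
def cubicNormForm (b x y z : ℤ) : ℤ :=
  16 * x ^ 3 + 4 * b * y ^ 3 + b ^ 2 * z ^ 3 - 12 * b * (x * y * z)

theorem even_of_even_mul_cube {b c x : ℤ} (hb : Odd b) (h : Even (b * x ^ 3 + 2 * c)) :
    Even x := by
  by_contra hx
  rw [Int.not_even_iff_odd] at hx
  have h1 : Odd (b * x ^ 3 + 2 * c) := (hb.mul (hx.pow)).add_even (even_two_mul c)
  exact (Int.not_even_iff_odd.2 h1) h

/-- The 2-adic valuations of `16 * x ^ 3`, `4 * b * y ^ 3` and `b ^ 2 * z ^ 3` fall in different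
classes modulo 3 when `b` is odd, so parity can be peeled off one variable at a time. Infinite
descent then makes the form anisotropic. -/
theorem cubicNormForm_descent {b x y z : ℤ} (hb : Odd b) (h : cubicNormForm b x y z = 0) :
    ∃ x' y' z', x = 2 * x' ∧ y = 2 * y' ∧ z = 2 * z' ∧ cubicNormForm b x' y' z' = 0 := by
  unfold cubicNormForm at h
  obtain ⟨z', rfl⟩ : Even z := even_of_even_mul_cube (hb.pow (n := 2))
    (c := 8 * x ^ 3 + 2 * b * y ^ 3 - 6 * b * (x * y * z)) ⟨0, by linarith⟩
  have h1 : 4 * x ^ 3 + b * y ^ 3 + 2 * b ^ 2 * z' ^ 3 - 6 * b * (x * y * z') = 0 := by linarith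
  obtain ⟨y', rfl⟩ : Even y := even_of_even_mul_cube hb
    (c := 2 * x ^ 3 + b ^ 2 * z' ^ 3 - 3 * b * (x * y * z')) ⟨0, by linarith⟩
  have h2 : 2 * x ^ 3 + 4 * b * y' ^ 3 + b ^ 2 * z' ^ 3 - 6 * b * (x * y' * z') = 0 := by linarith
  obtain ⟨z'', rfl⟩ : Even z' := even_of_even_mul_cube (hb.pow (n := 2))
    (c := x ^ 3 + 2 * b * y' ^ 3 - 3 * b * (x * y' * z')) ⟨0, by linarith⟩
  have h3 : x ^ 3 + 2 * b * y' ^ 3 + 4 * b ^ 2 * z'' ^ 3 - 6 * b * (x * y' * z'') = 0 := by linarith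
  obtain ⟨x', rfl⟩ : Even x := even_of_even_mul_cube odd_one
    (c := b * y' ^ 3 + 2 * b ^ 2 * z'' ^ 3 - 3 * b * (x * y' * z'')) ⟨0, by linarith⟩
  have h4 : 4 * x' ^ 3 + b * y' ^ 3 + 2 * b ^ 2 * z'' ^ 3 - 6 * b * (x' * y' * z'') = 0 := by
    linarith
  exact ⟨x', y', 2 * z'', by ring, by ring, by ring, by unfold cubicNormForm; linarith⟩

theorem cubicNormForm_eq_zero {b : ℤ} (hb : Odd b) :
    ∀ (s : ℕ) (x y z : ℤ), x.natAbs + y.natAbs + z.natAbs ≤ s → cubicNormForm b x y z = 0 →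
      x = 0 ∧ y = 0 ∧ z = 0 := by
  intro s
  induction s with
  | zero => intro x y z hs _; omega
  | succ s ih =>
    intro x y z hs h
    obtain ⟨x', y', z', rfl, rfl, rfl, h'⟩ := cubicNormForm_descent hb h
    by_cases h0 : x' = 0 ∧ y' = 0 ∧ z' = 0
    · omega
    · have := ih x' y' z' (by omega) h'
      omega

/-- A resultant lies in the ideal generated by its two polynomials; the proof displays the
cofactors. -/
theorem dvd_cubicNormForm {b x y z a k : ℤ} (hf : k ∣ 4 * a ^ 3 - b)
    (hg : k ∣ x + y * a + z * a ^ 2) : k ∣ cubicNormForm b x y z := by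
  have h : cubicNormForm b x y z =
      (x + y * a + z * a ^ 2) * (4 * ((4 * x ^ 2 - b * y * z) + (b * z ^ 2 - 4 * x * y) * a +
        4 * (y ^ 2 - x * z) * a ^ 2)) -
      (4 * a ^ 3 - b) * (4 * y ^ 3 - 8 * x * y * z + 4 * y ^ 2 * z * a - 4 * x * z ^ 2 * a
        + b * z ^ 3) := by
    unfold cubicNormForm; ring
  rw [h]
  exact dvd_sub (hg.mul_right _) (hf.mul_right _)

theorem prime_dvd_sq_add_mul_add_sq {b a a' q : ℤ} (hq : Prime q) (h2 : ¬ q ∣ 2)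
    (hf : q ∣ 4 * a ^ 3 - b) (hf' : q ∣ 4 * a' ^ 3 - b) (hne : ¬ q ∣ a - a') :
    q ∣ a ^ 2 + a * a' + a' ^ 2 := by
  have h : q ∣ 2 * (2 * ((a - a') * (a ^ 2 + a * a' + a' ^ 2))) := by
    exact (dvd_sub hf hf').trans (dvd_of_eq (by ring))
  rcases hq.dvd_or_dvd h with h | h
  · exact absurd h h2
  rcases hq.dvd_or_dvd h with h | h
  · exact absurd h h2
  exact (hq.dvd_or_dvd h).resolve_left hne

/-- Two common roots modulo `q` force a double zero of the resultant. Modulo `q` the quadratic is `z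
* (u - a) * (u - a')`, so `(x, y, z)` is a perturbation by multiples of `q` of `z * (a * a', -(a +
a'), 1)`. At `(a * a', -(a + a'), 1)` the form equals `f(a) * f(a')`, a multiple of `q ^ 2` (`e1`),
and its `x`- and `y`-derivatives are multiples of `q` (`e2`, `he`). -/
theorem sq_dvd_cubicNormForm {b x y z a a' q : ℤ} (hq : Prime q) (h2 : ¬ q ∣ 2)
    (hf : q ∣ 4 * a ^ 3 - b) (hf' : q ∣ 4 * a' ^ 3 - b) (hne : ¬ q ∣ a - a')
    (hg : q ∣ x + y * a + z * a ^ 2) (hg' : q ∣ x + y * a' + z * a' ^ 2) :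
    q ^ 2 ∣ cubicNormForm b x y z := by
  obtain ⟨e, he⟩ := prime_dvd_sq_add_mul_add_sq hq h2 hf hf' hne
  have hy : q ∣ y + z * (a + a') := by
    have h : q ∣ (a - a') * (y + z * (a + a')) := by
      exact (dvd_sub hg hg').trans (dvd_of_eq (by ring))
    exact (hq.dvd_or_dvd h).resolve_left hne
  have hx : q ∣ x - z * (a * a') := by
    exact (dvd_sub hg (hy.mul_right a)).trans (dvd_of_eq (by ring))
  obtain ⟨x1, hx1⟩ := hx
  obtain ⟨y1, hy1⟩ := hy
  obtain ⟨c, hc⟩ := hf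
  obtain ⟨c', hc'⟩ := hf'
  have ex : x = z * (a * a') + q * x1 := by linarith
  have ey : y = -(z * (a + a')) + q * y1 := by linarith
  have eb : b = 4 * a ^ 3 - q * c := by linarith
  have e1 : 16 * (a * a') ^ 3 - 4 * b * (a + a') ^ 3 + b ^ 2 + 12 * b * (a * a' * (a + a')) =
      q ^ 2 * (c * c') := by
    have : q ^ 2 * (c * c') = (4 * a ^ 3 - b) * (4 * a' ^ 3 - b) := by rw [hc, hc']; ring
    rw [this]; ring
  have e2 : 4 * (a * a') ^ 2 + b * (a + a') = q * (4 * a ^ 2 * e - c * (a + a')) := by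
    have : q * (4 * a ^ 2 * e - c * (a + a')) = 4 * a ^ 2 * (q * e) - q * c * (a + a') := by ring
    rw [this, ← he, eb]; ring
  refine ⟨z ^ 3 * (c * c') + 12 * z ^ 2 * x1 * (4 * a ^ 2 * e - c * (a + a'))
    + 12 * b * z ^ 2 * y1 * e + 48 * z * (a * a') * x1 ^ 2 - 12 * b * z * (a + a') * y1 ^ 2
    - 12 * b * z * x1 * y1 + q * (16 * x1 ^ 3 + 4 * b * y1 ^ 3), ?_⟩
  have expand : cubicNormForm b x y z =
      z ^ 3 * (16 * (a * a') ^ 3 - 4 * b * (a + a') ^ 3 + b ^ 2 + 12 * b * (a * a' * (a + a')))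
      + 12 * z ^ 2 * x1 * q * (4 * (a * a') ^ 2 + b * (a + a'))
      + 12 * b * z ^ 2 * y1 * q * (a ^ 2 + a * a' + a' ^ 2)
      + q ^ 2 * (48 * z * (a * a') * x1 ^ 2 - 12 * b * z * (a + a') * y1 ^ 2
        - 12 * b * z * x1 * y1 + q * (16 * x1 ^ 3 + 4 * b * y1 ^ 3)) := by
    rw [ex, ey]; unfold cubicNormForm; ring
  rw [expand, e1, e2, he]; ring

theorem abs_cubicNormForm_le {b x y z s : ℤ} (hx : |x| ≤ s) (hy : |y| ≤ s) (hz : |z| ≤ s) :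
    |cubicNormForm b x y z| ≤ (16 + 16 * |b| + b ^ 2) * s ^ 3 := by
  have h3 : ∀ w : ℤ, |w| ≤ s → |w ^ 3| ≤ s ^ 3 := fun w hw => by
    rw [abs_pow]; exact pow_le_pow_left₀ (abs_nonneg _) hw 3
  have hs : 0 ≤ s := (abs_nonneg x).trans hx
  have hxyz : |x * y * z| ≤ s ^ 3 := by
    rw [abs_mul, abs_mul]
    calc |x| * |y| * |z| ≤ s * s * s := by gcongr
      _ = s ^ 3 := by ring
  unfold cubicNormForm
  calc |16 * x ^ 3 + 4 * b * y ^ 3 + b ^ 2 * z ^ 3 - 12 * b * (x * y * z)|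
      ≤ |16 * x ^ 3 + 4 * b * y ^ 3 + b ^ 2 * z ^ 3| + |12 * b * (x * y * z)| := abs_sub _ _
    _ ≤ |16 * x ^ 3| + |4 * b * y ^ 3| + |b ^ 2 * z ^ 3| + |12 * b * (x * y * z)| := by
        gcongr; exact abs_add_three _ _ _
    _ = 16 * |x ^ 3| + 4 * |b| * |y ^ 3| + b ^ 2 * |z ^ 3| + 12 * |b| * |x * y * z| := by
        simp only [abs_mul, abs_of_nonneg (sq_nonneg b)]; norm_num
    _ ≤ 16 * s ^ 3 + 4 * |b| * s ^ 3 + b ^ 2 * s ^ 3 + 12 * |b| * s ^ 3 := by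
        gcongr
        exacts [h3 x hx, h3 y hy, h3 z hz]
    _ = _ := by ring

theorem exists_cube_le_lt (k : ℕ) : ∃ s : ℕ, s ^ 3 ≤ k ∧ k < (s + 1) ^ 3 := by
  induction k with
  | zero => exact ⟨0, by norm_num⟩
  | succ k ih =>
    obtain ⟨s, h1, h2⟩ := ih
    by_cases h : k + 1 < (s + 1) ^ 3
    · exact ⟨s, by omega, h⟩
    · refine ⟨s + 1, by omega, lt_of_lt_of_le (Nat.succ_lt_succ h2) ?_⟩
      exact Nat.succ_le_of_lt (Nat.pow_lt_pow_left (by omega) (by norm_num))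

/-- Thue's pigeonhole argument: the box has `(s + 1) ^ 3 > k` points, so two of them agree modulo
`k`. -/
theorem exists_short_vector (k s : ℕ) (hk : 0 < k) (hs : k < (s + 1) ^ 3) (a : ℤ) :
    ∃ x y z : ℤ, |x| ≤ s ∧ |y| ≤ s ∧ |z| ≤ s ∧ ¬ (x = 0 ∧ y = 0 ∧ z = 0) ∧
      (k : ℤ) ∣ x + y * a + z * a ^ 2 := by
  have : NeZero k := ⟨hk.ne'⟩
  have hcard : Fintype.card (ZMod k) < Fintype.card (Fin (s + 1) × Fin (s + 1) × Fin (s + 1)) := by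
    simp only [ZMod.card, Fintype.card_prod, Fintype.card_fin]
    calc k < (s + 1) ^ 3 := hs
      _ = _ := by ring
  obtain ⟨u, v, hne, h⟩ := Fintype.exists_ne_map_eq_of_card_lt
    (fun u : Fin (s + 1) × Fin (s + 1) × Fin (s + 1) =>
      (((u.1 : ℕ) : ℤ) + ((u.2.1 : ℕ) : ℤ) * a + ((u.2.2 : ℕ) : ℤ) * a ^ 2 : ZMod k)) hcard
  obtain ⟨u1, u2, u3⟩ := u
  obtain ⟨v1, v2, v3⟩ := v
  refine ⟨(u1 : ℕ) - (v1 : ℕ), (u2 : ℕ) - (v2 : ℕ), (u3 : ℕ) - (v3 : ℕ), ?_, ?_, ?_, ?_, ?_⟩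
  · rw [abs_le]; omega
  · rw [abs_le]; omega
  · rw [abs_le]; omega
  · rintro ⟨h1, h2, h3⟩
    apply hne
    simp only [Prod.mk.injEq, Fin.ext_iff]
    omega
  · rw [← ZMod.intCast_zmod_eq_zero_iff_dvd]
    simp only at h
    push_cast at h ⊢
    linear_combination h

/-- At a prime `q ∣ k` separating the two roots, `q ^ 2` divides `k * j`; as `k` is squarefree, `q ∣
j ∣ a - a'`, a contradiction. -/
theorem squarefree_dvd_sub_of_dvd_sub {b x y z a a' j : ℤ} {k : ℕ} (hk : Squarefree k)
    (h2 : ¬ 2 ∣ k) (hf : (k : ℤ) ∣ 4 * a ^ 3 - b) (hf' : (k : ℤ) ∣ 4 * a' ^ 3 - b)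
    (hg : (k : ℤ) ∣ x + y * a + z * a ^ 2) (hg' : (k : ℤ) ∣ x + y * a' + z * a' ^ 2)
    (hj : cubicNormForm b x y z = k * j) (haj : j ∣ a - a') : (k : ℤ) ∣ a - a' := by
  rw [Int.natCast_dvd,
    ← Nat.prod_primeFactors_of_squarefree hk]
  refine Finset.prod_primes_dvd _ (fun q hq => (Nat.prime_of_mem_primeFactors hq).prime) ?_
  intro q hq
  have hqp := Nat.prime_of_mem_primeFactors hq
  have hqk := Nat.dvd_of_mem_primeFactors hq
  have hqk' : (q : ℤ) ∣ k := by exact_mod_cast hqk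
  rw [← Int.natCast_dvd]
  by_contra hne
  have hq2 : ¬ (q : ℤ) ∣ 2 := by
    intro h
    have h3 : q ∣ 2 := by exact_mod_cast h
    rw [(Nat.prime_dvd_prime_iff_eq hqp Nat.prime_two).1 h3] at hqk
    exact h2 hqk
  have hsq := sq_dvd_cubicNormForm (Nat.prime_iff_prime_int.1 hqp) hq2 (hqk'.trans hf)
    (hqk'.trans hf') hne (hqk'.trans hg) (hqk'.trans hg')
  obtain ⟨k', rfl⟩ := hqk
  have hqk2 : ¬ (q : ℤ) ∣ k' := by
    intro h
    have h3 : q * q ∣ q * k' := mul_dvd_mul_left q (by exact_mod_cast h)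
    exact hqp.one_lt.ne' (Nat.isUnit_iff.1 (hk q h3))
  rw [hj] at hsq
  push_cast at hsq
  rw [sq, mul_assoc] at hsq
  have hq0 : (q : ℤ) ≠ 0 := by exact_mod_cast hqp.ne_zero
  rcases (Nat.prime_iff_prime_int.1 hqp).dvd_or_dvd ((mul_dvd_mul_iff_left hq0).1 hsq) with h | h
  · exact hqk2 h
  · exact hne (h.trans haj)

/-- A short vector has entries at most `k ^ (1/3)`, so its norm is `k * j` with `j` bounded in terms
of `b`, and `j ≠ 0` by anisotropy. The vector and `j` recover `k`; the residue of the root modulo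
`j` then recovers the root. There are `O(S ^ 3) = O(K)` such codes. -/
theorem exists_card_roots_le {b : ℤ} (hb : Odd b) : ∃ C : ℕ, ∀ K : ℕ,
    (((Finset.range (K + 1)) ×ˢ (Finset.range (K + 1))).filter
      (fun p : ℕ × ℕ => Squarefree p.1 ∧ p.2 < p.1 ∧ (p.1 : ℤ) ∣ 4 * (p.2 : ℤ) ^ 3 - b)).card
      ≤ C * K := by
  set D : ℕ := (16 + 16 * |b| + b ^ 2).toNat with hD
  have hD' : (D : ℤ) = 16 + 16 * |b| + b ^ 2 := Int.toNat_of_nonneg (by positivity)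
  refine ⟨27 * ((2 * D + 1) * (D + 1)), fun K => ?_⟩
  obtain ⟨S, hS1, hS2⟩ := exists_cube_le_lt K
  set P := ((Finset.range (K + 1)) ×ˢ (Finset.range (K + 1))).filter
      (fun p : ℕ × ℕ => Squarefree p.1 ∧ p.2 < p.1 ∧ (p.1 : ℤ) ∣ 4 * (p.2 : ℤ) ^ 3 - b) with hP
  have key : ∀ p : ℕ × ℕ, ∃ v : ℤ × ℤ × ℤ × ℤ, p ∈ P →
      |v.1| ≤ S ∧ |v.2.1| ≤ S ∧ |v.2.2.1| ≤ S ∧ |v.2.2.2| ≤ D ∧ v.2.2.2 ≠ 0 ∧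
      cubicNormForm b v.1 v.2.1 v.2.2.1 = p.1 * v.2.2.2 ∧
      (p.1 : ℤ) ∣ v.1 + v.2.1 * p.2 + v.2.2.1 * (p.2 : ℤ) ^ 2 := by
    rintro ⟨k, a⟩
    by_cases hp : (k, a) ∈ P
    swap
    · exact ⟨0, fun h => absurd h hp⟩
    simp only [hP, Finset.mem_filter, Finset.mem_product, Finset.mem_range] at hp
    obtain ⟨⟨hkK, -⟩, hsq, hak, hdvd⟩ := hp
    have hk0 : 0 < k := by omega
    obtain ⟨s, hs1, hs2⟩ := exists_cube_le_lt k
    have hsS : s ≤ S := by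
      by_contra hlt
      have : (S + 1) ^ 3 ≤ s ^ 3 := Nat.pow_le_pow_left (by omega) 3
      omega
    have hsS' : (s : ℤ) ≤ S := by exact_mod_cast hsS
    obtain ⟨x, y, z, hx, hy, hz, hne, hg⟩ := exists_short_vector k s hk0 hs2 a
    obtain ⟨j, hj⟩ := dvd_cubicNormForm hdvd hg
    refine ⟨(x, y, z, j), fun _ => ⟨hx.trans hsS', hy.trans hsS', hz.trans hsS', ?_, ?_, hj, hg⟩⟩
    · have h1 := abs_cubicNormForm_le (b := b) hx hy hz
      have h2 : (s : ℤ) ^ 3 ≤ k := by exact_mod_cast hs1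
      have hk0' : (0 : ℤ) < k := by exact_mod_cast hk0
      rw [hj, ← hD', abs_mul, abs_of_pos hk0'] at h1
      have h3 : (k : ℤ) * |j| ≤ k * D := by
        calc (k : ℤ) * |j| ≤ D * (s : ℤ) ^ 3 := h1
          _ ≤ D * k := by gcongr
          _ = _ := mul_comm _ _
      exact le_of_mul_le_mul_left h3 hk0'
    · rintro rfl
      rw [mul_zero] at hj
      exact hne (cubicNormForm_eq_zero hb _ x y z le_rfl hj)
  choose F hF using key
  set I := Finset.Icc (-(S : ℤ)) S with hI
  have hcard : P.card ≤
      ((I ×ˢ I ×ˢ I ×ˢ Finset.Icc (-(D : ℤ)) D) ×ˢ Finset.Icc (0 : ℤ) D).card := by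
    apply Finset.card_le_card_of_injOn (fun p => (F p, (p.2 : ℤ) % (F p).2.2.2))
    · intro p hp
      obtain ⟨h1, h2, h3, h4, h5, -, -⟩ := hF p hp
      have h6 := Int.emod_nonneg (p.2 : ℤ) h5
      have h7 := Int.emod_lt_abs (p.2 : ℤ) h5
      simp only [Finset.coe_product, Set.mem_prod, Finset.mem_coe, hI, Finset.mem_Icc]
      exact ⟨⟨abs_le.1 h1, abs_le.1 h2, abs_le.1 h3, abs_le.1 h4⟩, h6, by omega⟩
    · rintro ⟨k, a⟩ hp ⟨k', a'⟩ hp' heq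
      obtain ⟨-, -, -, -, h5, h6, h7⟩ := hF _ hp
      obtain ⟨-, -, -, -, -, h6', h7'⟩ := hF _ hp'
      simp only [Prod.mk.injEq] at heq
      obtain ⟨e1, e2⟩ := heq
      rw [← e1] at h6' h7' e2
      simp only at h6 h6' h7 h7'
      have hkk : k = k' := by
        have := h6.symm.trans h6'
        exact_mod_cast mul_right_cancel₀ h5 this
      subst hkk
      simp only [hP, Finset.mem_filter, Finset.mem_product, Finset.mem_range, Finset.mem_coe]
        at hp hp'
      have hodd : ¬ 2 ∣ k := by
        intro h2
        have h3 : (2 : ℤ) ∣ 4 * (a : ℤ) ^ 3 - b :=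
          (by exact_mod_cast h2 : (2 : ℤ) ∣ k).trans hp.2.2.2
        have h4 : (2 : ℤ) ∣ b := by omega
        exact (Int.not_even_iff_odd.2 hb) (even_iff_two_dvd.2 h4)
      have h8 := squarefree_dvd_sub_of_dvd_sub hp.2.1 hodd hp.2.2.2 hp'.2.2.2 h7 h7' h6
        (Int.ModEq.dvd (Eq.symm e2))
      have h9 : (a : ℤ) = a' := by
        have := hp.2.2.1
        have := hp'.2.2.1
        have h10 : |(a : ℤ) - a'| < k := by rw [abs_lt]; omega
        have := Int.eq_zero_of_abs_lt_dvd h8 h10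
        omega
      simp only [Prod.mk.injEq, true_and]
      exact_mod_cast h9
  rcases Nat.eq_zero_or_pos K with rfl | hK
  · rw [mul_zero, Nat.le_zero, Finset.card_eq_zero, Finset.eq_empty_iff_forall_notMem]
    rintro ⟨k, a⟩ hp
    simp only [hP, Finset.mem_filter, Finset.mem_product, Finset.mem_range] at hp
    omega
  have hS0 : 1 ≤ S := by
    by_contra h
    have : S = 0 := by omega
    subst this
    omega
  have cI : I.card = 2 * S + 1 := by rw [hI, Int.card_Icc]; omega
  have cD : (Finset.Icc (-(D : ℤ)) D).card = 2 * D + 1 := by rw [Int.card_Icc]; omega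
  have cD' : (Finset.Icc (0 : ℤ) D).card = D + 1 := by rw [Int.card_Icc]; omega
  rw [Finset.card_product, Finset.card_product, Finset.card_product, Finset.card_product, cI, cD,
    cD'] at hcard
  calc P.card ≤ _ := hcard
    _ = (2 * S + 1) ^ 3 * ((2 * D + 1) * (D + 1)) := by ring
    _ ≤ (3 * S) ^ 3 * ((2 * D + 1) * (D + 1)) := by gcongr; omega
    _ = 27 * ((2 * D + 1) * (D + 1)) * S ^ 3 := by ring
    _ ≤ _ := by gcongr

/-! ### Primes congruent to 2 modulo 3 with slowly growing product. -/

theorem exists_prime_dvd_mod_three_eq_two (N : ℕ) (hN : N % 3 = 2) :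
    ∃ l, l.Prime ∧ l ∣ N ∧ l % 3 = 2 := by
  induction N using Nat.strong_induction_on with
  | _ N ih =>
    have h1 : N ≠ 1 := by rintro rfl; omega
    have hp := Nat.minFac_prime h1
    obtain ⟨m, hm⟩ := Nat.minFac_dvd N
    generalize N.minFac = p at hp hm
    by_cases h2 : p % 3 = 2
    · exact ⟨p, hp, ⟨m, hm⟩, h2⟩
    have h3 : N % 3 = (p % 3) * (m % 3) % 3 := by rw [hm, Nat.mul_mod]
    have hp3 : p % 3 < 3 := Nat.mod_lt _ (by norm_num)
    have hp1 : p % 3 = 1 := by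
      interval_cases h : p % 3 <;> omega
    have hm2 : m % 3 = 2 := by rw [hp1] at h3; omega
    have hm0 : 0 < m := by omega
    have hlt : m < N := by rw [hm]; exact lt_mul_left hm0 hp.one_lt
    obtain ⟨l, hl, hlm, hl2⟩ := ih m hlt hm2
    exact ⟨l, hl, hm ▸ hlm.mul_left p, hl2⟩

/-- Euclid's argument on a sum of two coprime parts, which bounds the new prime by the larger part
rather than by the product `A * B`. Over `2 * i` primes the exponent then grows like a Fibonacci
number, below `3 ^ i` up to a constant; doubling at each prime would give `4 ^ i`, too much for the
later series to converge. -/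
theorem exists_new_prime {A B : ℕ} (hA : Even A) (hA3 : ¬ 3 ∣ A) (hB : Odd B)
    (hAB : Nat.Coprime A B) :
    ∃ l, l.Prime ∧ l % 3 = 2 ∧ l ≠ 2 ∧ ¬ l ∣ A ∧ ¬ l ∣ B ∧ l ≤ 2 * A + 3 * B := by
  have hA3' : A % 3 ≠ 0 := fun h => hA3 (Nat.dvd_of_mod_eq_zero h)
  obtain ⟨c, hc, hcA⟩ : ∃ c, (c = 1 ∨ c = 2) ∧ (c * A) % 3 = 2 := by
    rcases (by omega : A % 3 = 1 ∨ A % 3 = 2) with h | h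
    · exact ⟨2, Or.inr rfl, by omega⟩
    · exact ⟨1, Or.inl rfl, by omega⟩
  obtain ⟨l, hl, hlN, hl3⟩ := exists_prime_dvd_mod_three_eq_two (c * A + 3 * B) (by omega)
  have hpar : (c * A + 3 * B) % 2 = 1 := by
    obtain ⟨u, rfl⟩ := hA
    obtain ⟨v, rfl⟩ := hB
    rcases hc with rfl | rfl <;> omega
  have hl2 : l ≠ 2 := by
    rintro rfl
    omega
  have hlA : ¬ l ∣ A := by
    intro h
    have h1 : l ∣ 3 * B := (Nat.dvd_add_right (h.mul_left c)).1 hlN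
    rcases (Nat.Prime.dvd_mul hl).1 h1 with h2 | h2
    · rw [(Nat.prime_dvd_prime_iff_eq hl Nat.prime_three).1 h2] at h
      exact hA3 h
    · exact Nat.not_coprime_of_dvd_of_dvd hl.one_lt h h2 hAB
  refine ⟨l, hl, hl3, hl2, hlA, ?_, ?_⟩
  · intro h
    have h1 : l ∣ c * A := (Nat.dvd_add_left (h.mul_left 3)).1 hlN
    rcases (Nat.Prime.dvd_mul hl).1 h1 with h2 | h2
    · rcases hc with rfl | rfl
      · exact hl.one_lt.ne' (Nat.dvd_one.1 h2)
      · exact hl2 ((Nat.prime_dvd_prime_iff_eq hl Nat.prime_two).1 h2)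
    · exact hlA h2
  · have := Nat.le_of_dvd (by omega) hlN
    rcases hc with rfl | rfl <;> omega

/-- Primes `l ≡ 2 mod 3` that divide neither `5` nor `d`, with product of Fibonacci-type growth. -/
theorem exists_primes_split {d : ℕ} (hd : Odd d) (r : ℕ) :
    ∃ (A B : ℕ) (P : Finset ℕ), P.card = r ∧ Even A ∧ ¬ 3 ∣ A ∧ Odd B ∧ Nat.Coprime A B ∧
      5 * d ∣ B ∧ (∀ l ∈ P, l.Prime ∧ l % 3 = 2 ∧ l ≠ 2 ∧ ¬ l ∣ 5 * d) ∧ (∏ l ∈ P, l) ∣ A * B ∧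
      ((5 * A ≤ (25 * d) ^ (Nat.fib (r + 1)) ∧ 5 * B ≤ (25 * d) ^ (Nat.fib (r + 2))) ∨
        (5 * B ≤ (25 * d) ^ (Nat.fib (r + 1)) ∧ 5 * A ≤ (25 * d) ^ (Nat.fib (r + 2)))) := by
  have hd0 : 0 < d := hd.pos
  induction r with
  | zero =>
    -- Keeping `5 * d` inside `B` bars 5 and the divisors of `d`; the bounds read `10 ≤ 25 * d` and
    -- `25 * d ≤ 25 * d`.
    refine ⟨2, 5 * d, ∅, rfl, even_two, by norm_num, ?_, ?_, dvd_rfl, by simp, by simp, ?_⟩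
    · exact Odd.mul (by decide) hd
    · exact Nat.coprime_two_left.2 (Odd.mul (by decide) hd)
    · left; simp; omega
  | succ r ih =>
    obtain ⟨A, B, P, hP, hA, hA3, hB, hAB, hdB, hPl, hdvd, hbd⟩ := ih
    obtain ⟨l, hl, hl3, hl2, hlA, hlB, hle⟩ := exists_new_prime hA hA3 hB hAB
    have hlP : l ∉ P := by
      intro h
      rcases (Nat.Prime.dvd_mul hl).1 ((Finset.dvd_prod_of_mem _ h).trans hdvd) with h | h
      exacts [hlA h, hlB h]
    have hcard : (insert l P).card = r + 1 := by rw [Finset.card_insert_of_notMem hlP, hP]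
    have hnew : ∀ q ∈ insert l P, q.Prime ∧ q % 3 = 2 ∧ q ≠ 2 ∧ ¬ q ∣ 5 * d := by
      intro q hq
      rcases Finset.mem_insert.1 hq with rfl | hq
      · exact ⟨hl, hl3, hl2, fun h => hlB (h.trans hdB)⟩
      · exact hPl q hq
    have hprod : (∏ q ∈ insert l P, q) ∣ l * (A * B) := by
      rw [Finset.prod_insert hlP]; exact mul_dvd_mul_left l hdvd
    have hodd : Odd l := hl.odd_of_ne_two hl2
    have hmono : (25 * d) ^ (Nat.fib (r + 1)) ≤ (25 * d) ^ (Nat.fib (r + 2)) :=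
      Nat.pow_le_pow_right (by omega) Nat.fib_le_fib_succ
    have hfib : (25 * d) ^ (Nat.fib (r + 1)) * (25 * d) ^ (Nat.fib (r + 2)) =
        (25 * d) ^ (Nat.fib (r + 3)) := by
      rw [← pow_add, ← Nat.fib_add_two]
    -- The factor 5 in the invariant absorbs `2 * A + 3 * B`. Below, `l` joins the part with the
    -- smaller bound.
    have hll : l ≤ (25 * d) ^ (Nat.fib (r + 2)) := by omega
    rcases hbd with ⟨h1, h2⟩ | ⟨h1, h2⟩
    · refine ⟨A * l, B, insert l P, hcard, hA.mul_right l, ?_, hB, ?_, hdB, hnew, ?_, ?_⟩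
      · intro h
        rcases (Nat.Prime.dvd_mul Nat.prime_three).1 h with h | h
        · exact hA3 h
        · have := (Nat.prime_dvd_prime_iff_eq Nat.prime_three hl).1 h
          omega
      · exact Nat.Coprime.mul_left hAB ((Nat.Prime.coprime_iff_not_dvd hl).2 hlB)
      · convert hprod using 1; ring
      · right
        refine ⟨h2, ?_⟩
        rw [← hfib, ← mul_assoc]
        exact Nat.mul_le_mul h1 hll
    · refine ⟨A, B * l, insert l P, hcard, hA, hA3, hB.mul hodd, ?_, hdB.mul_right l, hnew, ?_, ?_⟩
      · exact Nat.Coprime.mul_right hAB ((Nat.Prime.coprime_iff_not_dvd hl).2 hlA).symm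
      · convert hprod using 1; ring
      · left
        refine ⟨h2, ?_⟩
        rw [← hfib, ← mul_assoc]
        exact Nat.mul_le_mul h1 hll

theorem fib_two_mul_add_three_le (i : ℕ) : Nat.fib (2 * i + 3) ≤ 2 * 3 ^ i := by
  induction i with
  | zero => decide
  | succ i ih =>
    have h1 : Nat.fib (2 * (i + 1) + 3) = Nat.fib (2 * i + 3) + Nat.fib (2 * i + 3 + 1) :=
      Nat.fib_add_two (n := 2 * i + 3)
    have h2 : Nat.fib (2 * i + 3 + 1) = Nat.fib (2 * i + 2) + Nat.fib (2 * i + 3) :=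
      Nat.fib_add_two (n := 2 * i + 2)
    have h3 : Nat.fib (2 * i + 2) ≤ Nat.fib (2 * i + 3) := Nat.fib_le_fib_succ
    rw [pow_succ]; omega

/-- There are `2 * i` primes `l ≡ 2 mod 3` with `11 ≤ l`, not dividing `d`, with product at most
`2 ^ (c * 3 ^ i)`. -/
theorem exists_primes_prod_le {d : ℕ} (hd : Odd d) : ∃ c : ℕ, 0 < c ∧ ∀ i : ℕ,
    ∃ P : Finset ℕ, P.card = 2 * i ∧
      (∀ l ∈ P, l.Prime ∧ l % 3 = 2 ∧ 11 ≤ l ∧ ¬ l ∣ d) ∧ (∏ l ∈ P, l) ≤ 2 ^ (c * 3 ^ i) := by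
  refine ⟨25 * d * 2, by have := hd.pos; omega, fun i => ?_⟩
  obtain ⟨A, B, P, hP, -, hA3, hB, -, -, hPl, hdvd, hbd⟩ := exists_primes_split hd (2 * i)
  refine ⟨P, hP, fun l hl => ?_, ?_⟩
  · obtain ⟨h1, h2, h3, h4⟩ := hPl l hl
    refine ⟨h1, h2, ?_, fun h => h4 (h.mul_left 5)⟩
    by_contra hlt
    have h5 : l ≠ 5 := by rintro rfl; exact h4 (dvd_mul_right _ _)
    have h8 : l ≠ 8 := by rintro rfl; revert h1; decide
    omega
  · have hA0 : 0 < A := Nat.pos_of_ne_zero (by rintro rfl; exact hA3 (dvd_zero 3))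
    have h1 : ∏ l ∈ P, l ≤ A * B := Nat.le_of_dvd (Nat.mul_pos hA0 hB.pos) hdvd
    have h2 : A * B ≤ (25 * d) ^ Nat.fib (2 * i + 3) := by
      have hfib : (25 * d) ^ (Nat.fib (2 * i + 1)) * (25 * d) ^ (Nat.fib (2 * i + 2)) =
          (25 * d) ^ (Nat.fib (2 * i + 3)) := by
        rw [← pow_add, ← Nat.fib_add_two]
      rw [← hfib]
      rcases hbd with ⟨h, h'⟩ | ⟨h, h'⟩
      · exact Nat.mul_le_mul (by omega) (by omega)
      · rw [mul_comm]; exact Nat.mul_le_mul (by omega) (by omega)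
    calc ∏ l ∈ P, l ≤ (25 * d) ^ Nat.fib (2 * i + 3) := h1.trans h2
      _ ≤ (25 * d) ^ (2 * 3 ^ i) :=
        Nat.pow_le_pow_right (by have := hd.pos; omega) (fib_two_mul_add_three_le i)
      _ ≤ (2 ^ (25 * d)) ^ (2 * 3 ^ i) := Nat.pow_le_pow_left Nat.lt_two_pow_self.le _
      _ = 2 ^ (25 * d * 2 * 3 ^ i) := by rw [← pow_mul]; ring_nf

/-! ### Sieving for square values along a progression. -/

theorem eq_zero_of_sq_add_mul_add_sq {l : ℕ} [Fact l.Prime] (hl : l % 3 = 2) {u v : ZMod l}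
    (h : u ^ 2 + u * v + v ^ 2 = 0) : u = 0 ∧ v = 0 := by
  have hv : v = 0 := by
    by_contra hv
    have h1 : (u / v) ^ 2 + u / v + 1 = 0 := by
      field_simp
      linear_combination h
    have h3 : (u / v) ^ 3 = 1 := by linear_combination (u / v - 1) * h1
    have hne0 : u / v ≠ 0 := by
      intro h0; rw [h0] at h1; simp at h1
    have hne1 : u / v ≠ 1 := by
      intro h0
      rw [h0] at h1
      have h30 : ((3 : ℕ) : ZMod l) = 0 := by push_cast; linear_combination h1
      rw [ZMod.natCast_eq_zero_iff] at h30
      have := (Nat.prime_dvd_prime_iff_eq (Fact.out : l.Prime) Nat.prime_three).1 h30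
      omega
    have hord : orderOf (u / v) = 3 := orderOf_eq_prime h3 hne1
    have hdvd : 3 ∣ l - 1 := hord ▸ ZMod.orderOf_dvd_card_sub_one hne0
    omega
  subst hv
  simpa using h

/-- A difference of values is `4 * (t - t')` times the form `u ^ 2 + u * v + v ^ 2` at `a + k * t`,
`a + k * t'`, which is anisotropic modulo `l ≡ 2 mod 3`. The condition `b ≠ 0` excludes `a = k = 0`.
-/
theorem shiftedCubic_injective {l : ℕ} [Fact l.Prime] (hl : l % 3 = 2) (hl2 : l ≠ 2)
    {a k e b : ZMod l} (hb : b ≠ 0) (he : 4 * a ^ 3 - b = k * e) :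
    Function.Injective
      (fun t : ZMod l => e + 4 * (3 * a ^ 2 * t + 3 * a * k * t ^ 2 + k ^ 2 * t ^ 3)) := by
  intro t t' h
  have h2 : (2 : ZMod l) ≠ 0 := by
    intro h0
    have h20 : ((2 : ℕ) : ZMod l) = 0 := by push_cast; exact h0
    rw [ZMod.natCast_eq_zero_iff] at h20
    exact hl2 ((Nat.prime_dvd_prime_iff_eq (Fact.out : l.Prime) Nat.prime_two).1 h20)
  have h1 : 2 * 2 * ((t - t') * ((a + k * t) ^ 2 + (a + k * t) * (a + k * t') +
      (a + k * t') ^ 2)) = 0 := by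
    simp only at h
    linear_combination h
  rcases mul_eq_zero.1 ((mul_eq_zero.1 h1).resolve_left (mul_ne_zero h2 h2)) with h3 | h3
  · exact sub_eq_zero.1 h3
  obtain ⟨h4, h5⟩ := eq_zero_of_sq_add_mul_add_sq hl h3
  have h6 : k * (t - t') = 0 := by linear_combination h4 - h5
  rcases mul_eq_zero.1 h6 with h7 | h7
  · subst h7
    exfalso
    apply hb
    have ha : a = 0 := by linear_combination h4
    subst ha
    linear_combination -he
  · exact sub_eq_zero.1 h7

open scoped Classical in
theorem card_filter_isSquare_le {l : ℕ} [NeZero l] :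
    (Finset.univ.filter (fun x : ZMod l => IsSquare x)).card ≤ l / 2 + 1 := by
  calc _ ≤ ((Finset.range (l / 2 + 1)).image (fun i : ℕ => (i : ZMod l) ^ 2)).card := by
        apply Finset.card_le_card
        intro x hx
        obtain ⟨y, rfl⟩ := (Finset.mem_filter.1 hx).2
        refine Finset.mem_image.2 ⟨y.valMinAbs.natAbs, ?_, ?_⟩
        · rw [Finset.mem_range]
          have := ZMod.natAbs_valMinAbs_le y
          omega
        · have h : ((y.valMinAbs.natAbs : ℤ) : ZMod l) ^ 2 = y ^ 2 := by
            rw [← Int.cast_pow, Int.natCast_natAbs, sq_abs, Int.cast_pow, ZMod.coe_valMinAbs]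
          rw [← sq, ← h, Int.cast_natCast]
    _ ≤ _ := Finset.card_image_le.trans (by simp)

/-- The value at `t` of `(4 * (a + k * t) ^ 3 - b) / k`, where `4 * a ^ 3 - b = k * e`. -/
def shiftedCubic (a k e : ℤ) (t : ℤ) : ℤ :=
  e + 4 * (3 * a ^ 2 * t + 3 * a * k * t ^ 2 + k ^ 2 * t ^ 3)

open scoped Classical in
theorem card_residues_le {l : ℕ} (hlp : l.Prime) (hl : l % 3 = 2) (hl2 : l ≠ 2)
    {a k e b : ℤ} (hb : ¬ (l : ℤ) ∣ b) (he : 4 * a ^ 3 - b = k * e) :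
    ((Finset.range l).filter
      (fun t : ℕ => IsSquare ((shiftedCubic a k e t : ℤ) : ZMod l))).card ≤ l / 2 + 1 := by
  have := Fact.mk hlp
  refine le_trans ?_ (card_filter_isSquare_le (l := l))
  have hb' : ((b : ℤ) : ZMod l) ≠ 0 := by rwa [Ne, ZMod.intCast_zmod_eq_zero_iff_dvd]
  have he' : 4 * (a : ZMod l) ^ 3 - (b : ZMod l) = k * e := by exact_mod_cast congrArg _ he
  have hinj := shiftedCubic_injective hl hl2 hb' he'
  refine Finset.card_le_card_of_injOn
    (fun t : ℕ => ((shiftedCubic a k e t : ℤ) : ZMod l)) ?_ ?_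
  · intro t ht
    simp only [Finset.coe_filter, Set.mem_ofPred_eq, Finset.mem_univ, true_and] at ht ⊢
    exact ht.2
  · intro t ht t' ht' h
    simp only [Finset.coe_filter, Set.mem_ofPred_eq, Finset.mem_range] at ht ht'
    have h1 : (t : ZMod l) = (t' : ZMod l) := by
      apply hinj
      simpa [shiftedCubic] using h
    rw [ZMod.natCast_eq_natCast_iff'] at h1
    rwa [Nat.mod_eq_of_lt ht.1, Nat.mod_eq_of_lt ht'.1] at h1

-- By the Chinese remainder theorem, `t` is determined by its block of length `∏ l` and its
-- residues, each confined to at most `l / 2 + 1` classes.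
open scoped Classical in
theorem card_square_values_le {P : Finset ℕ} {a k e b : ℤ}
    (hP : ∀ l ∈ P, l.Prime ∧ l % 3 = 2 ∧ l ≠ 2 ∧ ¬ (l : ℤ) ∣ b)
    (he : 4 * a ^ 3 - b = k * e) (T : ℕ) :
    ((Finset.range T).filter (fun t : ℕ => IsSquare (shiftedCubic a k e t))).card ≤
      (T / (∏ l ∈ P, l) + 1) * ∏ l ∈ P, (l / 2 + 1) := by
  set M := ∏ l ∈ P, l with hM
  let S : P → Finset ℕ := fun l => (Finset.range l).filter
      (fun t : ℕ => IsSquare ((shiftedCubic a k e t : ℤ) : ZMod l))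
  have hS : (Fintype.piFinset S).card ≤ ∏ l ∈ P, (l / 2 + 1) := by
    rw [Fintype.card_piFinset, ← Finset.prod_coe_sort P (fun l => l / 2 + 1)]
    refine Finset.prod_le_prod' fun l _ => ?_
    obtain ⟨h1, h2, h3, h4⟩ := hP l l.2
    exact card_residues_le h1 h2 h3 h4 he
  calc _ ≤ ((Finset.range (T / M + 1)) ×ˢ Fintype.piFinset S).card := ?_
    _ ≤ _ := by
      rw [Finset.card_product, Finset.card_range]
      exact Nat.mul_le_mul_left _ hS
  refine Finset.card_le_card_of_injOn (fun t => (t / M, fun l : P => t % l)) ?_ ?_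
  · intro t ht
    simp only [Finset.coe_filter, Set.mem_ofPred_eq, Finset.mem_range] at ht
    simp only [Finset.coe_product, Set.mem_prod, Finset.mem_coe, Finset.mem_range,
      Fintype.mem_piFinset]
    refine ⟨Nat.lt_succ_of_le (Nat.div_le_div_right ht.1.le), fun l => ?_⟩
    simp only [S, Finset.mem_filter, Finset.mem_range]
    refine ⟨Nat.mod_lt _ (hP l l.2).1.pos, ?_⟩
    have h1 : ((shiftedCubic a k e ((t % l : ℕ) : ℤ) : ℤ) : ZMod l) =
        ((shiftedCubic a k e (t : ℤ) : ℤ) : ZMod l) := by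
      simp [shiftedCubic]
    rw [h1]
    exact ht.2.map (Int.castRingHom (ZMod l))
  · intro t ht t' ht' h
    simp only [Prod.mk.injEq, funext_iff] at h
    have hmod : t ≡ t' [MOD M] := by
      rw [hM, Nat.modEq_iff_dvd, Nat.cast_prod]
      refine Finset.prod_dvd_of_coprime ?_ fun l hl => ?_
      · intro l hl l' hl' hne
        exact Nat.isCoprime_iff_coprime.2
          ((Nat.coprime_primes (hP l hl).1 (hP l' hl').1).2 hne)
      · exact Nat.modEq_iff_dvd.1 (h.2 ⟨l, hl⟩)
    rw [← Nat.div_add_mod t M, ← Nat.div_add_mod t' M, h.1, hmod]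

theorem prod_half_le {P : Finset ℕ} (hP : ∀ l ∈ P, 11 ≤ l ∧ l ≠ 2 ∧ l.Prime) :
    ((∏ l ∈ P, (l / 2 + 1) : ℕ) : ℝ) ≤ (6 / 11) ^ P.card * ((∏ l ∈ P, l : ℕ) : ℝ) := by
  push_cast
  rw [← Finset.prod_const, ← Finset.prod_mul_distrib]
  refine Finset.prod_le_prod (fun l _ => by positivity) fun l hl => ?_
  obtain ⟨h1, h2, h3⟩ := hP l hl
  obtain ⟨m, rfl⟩ := h3.odd_of_ne_two h2
  have h4 : (2 * m + 1) / 2 = m := by omega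
  rw [h4]
  have h5 : (5 : ℝ) ≤ m := by exact_mod_cast (by omega : 5 ≤ m)
  push_cast
  linarith

theorem summable_pow_log (c : ℕ) (hc : 0 < c) :
    Summable (fun j : ℕ => 4 * (36 / 121 : ℝ) ^ (Nat.log 3 ((j + 1) / c))) := by
  apply Summable.mul_left
  have hs : Summable (fun j : ℕ => (3 * c : ℝ) ^ (11 / 10 : ℝ) *
      (((j + 1 : ℕ) : ℝ) ^ (-(11 / 10) : ℝ))) :=
    (((summable_nat_add_iff 1).2 (Real.summable_nat_rpow.2 (by norm_num))).mul_left _)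
  refine Summable.of_nonneg_of_le (fun j => by positivity) (fun j => ?_) hs
  set i := Nat.log 3 ((j + 1) / c) with hi
  have h1 : (j + 1) / c < 3 ^ (i + 1) := Nat.lt_pow_succ_log_self (by norm_num) _
  have h2 : j + 1 < 3 ^ (i + 1) * c := (Nat.div_lt_iff_lt_mul hc).1 h1
  have h3 : ((j + 1 : ℕ) : ℝ) ≤ 3 ^ i * (3 * c) := by
    have : ((j + 1 : ℕ) : ℝ) ≤ ((3 ^ (i + 1) * c : ℕ) : ℝ) := by exact_mod_cast h2.le
    refine this.trans (le_of_eq ?_)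
    push_cast; ring
  -- The numerical heart: `3 ^ (11/10) ≤ 121/36`, so the terms decay like `j ^ (-11/10)`.
  have hθ : (36 / 121 : ℝ) ≤ (3 : ℝ) ^ (-(11 / 10) : ℝ) := by
    rw [Real.rpow_neg (by norm_num), ← inv_inv (36 / 121 : ℝ)]
    apply inv_anti₀ (by positivity)
    have h10 : ((3 : ℝ) ^ (11 / 10 : ℝ)) ^ (10 : ℕ) ≤ ((36 / 121 : ℝ)⁻¹) ^ (10 : ℕ) := by
      rw [← Real.rpow_natCast, ← Real.rpow_mul (by norm_num)]
      norm_num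
    exact le_of_pow_le_pow_left₀ (by norm_num) (by norm_num) h10
  have hj : (0 : ℝ) < ((j + 1 : ℕ) : ℝ) := by positivity
  have hc' : (0 : ℝ) < c := by exact_mod_cast hc
  calc (36 / 121 : ℝ) ^ i ≤ ((3 : ℝ) ^ (-(11 / 10) : ℝ)) ^ i :=
        pow_le_pow_left₀ (by norm_num) hθ i
    _ = ((3 : ℝ) ^ i) ^ (-(11 / 10) : ℝ) := by
        rw [← Real.rpow_natCast, ← Real.rpow_natCast, ← Real.rpow_mul (by norm_num),
          ← Real.rpow_mul (by norm_num), mul_comm]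
    _ = (3 * c : ℝ) ^ (11 / 10 : ℝ) * (3 ^ i * (3 * c)) ^ (-(11 / 10) : ℝ) := by
        have hd : (0 : ℝ) < 3 * c := by positivity
        generalize (3 * c : ℝ) = d at hd
        rw [Real.mul_rpow (by positivity) hd.le, mul_left_comm, ← Real.rpow_add hd, add_neg_cancel,
          Real.rpow_zero, mul_one]
    _ ≤ _ := by
        gcongr ?_ * ?_
        exact Real.rpow_le_rpow_of_nonpos hj h3 (by norm_num)

open scoped Classical in
theorem exists_summable_sieve_bound {b : ℤ} (hb : Odd b) : ∃ s : ℕ → ℝ, Summable s ∧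
    (∀ j, 0 ≤ s j) ∧ ∀ (j k a : ℕ), 0 < k → (k : ℤ) ∣ 4 * (a : ℤ) ^ 3 - b →
      ((((Finset.range (2 ^ (j + 1))).filter (fun t : ℕ => ∃ y : ℤ,
        4 * ((a : ℤ) + k * t) ^ 3 - b = k * y ^ 2)).card : ℕ) : ℝ) ≤ s j * 2 ^ j := by
  obtain ⟨c, hc, H⟩ := exists_primes_prod_le (d := b.natAbs) (Int.natAbs_odd.2 hb)
  refine ⟨fun j => 4 * (36 / 121 : ℝ) ^ (Nat.log 3 ((j + 1) / c)), summable_pow_log c hc,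
    fun j => by positivity, ?_⟩
  rintro j k a hk ⟨e, he⟩
  simp only
  set i := Nat.log 3 ((j + 1) / c) with hi
  -- Here `Nat.log` takes its default value 0, and the factor 4 covers the trivial bound `2 ^ (j +
  -- 1)`.
  by_cases hjc : (j + 1) / c = 0
  · have hi0 : i = 0 := by rw [hi, hjc]; simp
    rw [hi0, pow_zero, mul_one]
    have h1 : ((Finset.range (2 ^ (j + 1))).filter (fun t : ℕ => ∃ y : ℤ,
        4 * ((a : ℤ) + k * t) ^ 3 - b = k * y ^ 2)).card ≤ 2 ^ (j + 1) :=
      (Finset.card_filter_le _ _).trans (by simp)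
    have h2 : ((2 ^ (j + 1) : ℕ) : ℝ) ≤ 4 * 2 ^ j := by
      push_cast; rw [pow_succ]; nlinarith [pow_pos (two_pos : (0 : ℝ) < 2) j]
    exact le_trans (by exact_mod_cast h1) h2
  obtain ⟨P, hPc, hP, hprod⟩ := H i
  set M := ∏ l ∈ P, l with hM
  have hci : c * 3 ^ i ≤ j + 1 := by
    have := Nat.pow_log_le_self 3 hjc
    calc c * 3 ^ i ≤ c * ((j + 1) / c) := Nat.mul_le_mul_left c this
      _ ≤ j + 1 := Nat.mul_div_le _ _
  -- The choice of `i` keeps the sieve modulus within the range of `t`, so rounding up the number of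
  -- blocks costs at most a factor 2.
  have hMT : M ≤ 2 ^ (j + 1) := hprod.trans (Nat.pow_le_pow_right (by norm_num) hci)
  have hM0 : 0 < M := Finset.prod_pos fun l hl => (hP l hl).1.pos
  have hP' : ∀ l ∈ P, l.Prime ∧ l % 3 = 2 ∧ l ≠ 2 ∧ ¬ (l : ℤ) ∣ b := fun l hl => by
    obtain ⟨h1, h2, h3, h4⟩ := hP l hl
    exact ⟨h1, h2, by omega, fun h => h4 (Int.natCast_dvd.1 h)⟩
  have h1 := card_square_values_le hP' he (2 ^ (j + 1))
  have h2 := prod_half_le fun l hl => ⟨(hP l hl).2.2.1, (hP' l hl).2.2.1, (hP l hl).1⟩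
  have h3 : ((Finset.range (2 ^ (j + 1))).filter (fun t : ℕ => ∃ y : ℤ,
        4 * ((a : ℤ) + k * t) ^ 3 - b = k * y ^ 2)).card ≤
      ((Finset.range (2 ^ (j + 1))).filter
        (fun t : ℕ => IsSquare (shiftedCubic a k e t))).card := by
    refine Finset.card_le_card fun t ht => ?_
    obtain ⟨ht1, y, hy⟩ := Finset.mem_filter.1 ht
    refine Finset.mem_filter.2 ⟨ht1, y, ?_⟩
    have hk' : (k : ℤ) ≠ 0 := by exact_mod_cast hk.ne'
    apply mul_left_cancel₀ hk'
    unfold shiftedCubic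
    linear_combination hy - he
  have hMr : (0 : ℝ) < M := by exact_mod_cast hM0
  have h4 : ((2 ^ (j + 1) / M + 1 : ℕ) : ℝ) ≤ 2 * (2 ^ (j + 1) / M) := by
    have h5 : ((2 ^ (j + 1) / M : ℕ) : ℝ) ≤ 2 ^ (j + 1) / M := by
      have := @Nat.cast_div_le ℝ _ _ _ (2 ^ (j + 1)) M
      push_cast at this
      exact this
    have h6 : (1 : ℝ) ≤ 2 ^ (j + 1) / M := by
      rw [le_div_iff₀ hMr, one_mul]; exact_mod_cast hMT
    push_cast at h5 ⊢
    linarith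
  calc _ ≤ (((2 ^ (j + 1) / M + 1) * ∏ l ∈ P, (l / 2 + 1) : ℕ) : ℝ) := by
        exact_mod_cast h3.trans h1
    _ = ((2 ^ (j + 1) / M + 1 : ℕ) : ℝ) * ((∏ l ∈ P, (l / 2 + 1) : ℕ) : ℝ) := by
        rw [Nat.cast_mul]
    _ ≤ 2 * (2 ^ (j + 1) / M) * ((6 / 11) ^ P.card * M) := by gcongr
    _ = 4 * (6 / 11) ^ P.card * 2 ^ j := by field_simp; ring
    _ = _ := by rw [hPc, pow_mul]; norm_num

/-! ### Divisibility by squares of medium primes. -/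

-- Roots modulo `p` are simple, so two solutions modulo `p ^ 2` that agree modulo `p` agree modulo
-- `p ^ 2`; there are at most three roots modulo `p`.
open scoped Classical in
theorem card_sq_dvd_le {p : ℕ} (hp : p.Prime) {b : ℤ} (h2 : p ≠ 2) (h3 : p ≠ 3)
    (hb : ¬ (p : ℤ) ∣ b) {W : ℕ} (hW : ¬ p ∣ W) (m N : ℕ) :
    ((Finset.range N).filter
      (fun i : ℕ => ((p : ℤ) ^ 2 ∣ 4 * ((m : ℤ) + W * i) ^ 3 - b))).card ≤ 3 * (N / p ^ 2 + 1) := by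
  have := Fact.mk hp
  have hpi : Prime (p : ℤ) := Nat.prime_iff_prime_int.1 hp
  have hp2 : ¬ (p : ℤ) ∣ 2 := fun h =>
    h2 ((Nat.prime_dvd_prime_iff_eq hp Nat.prime_two).1 (by exact_mod_cast h))
  have hp3 : ¬ (p : ℤ) ∣ 3 := fun h =>
    h3 ((Nat.prime_dvd_prime_iff_eq hp Nat.prime_three).1 (by exact_mod_cast h))
  have h4 : (4 : ZMod p) ≠ 0 := by
    intro h
    have h' : ((4 : ℤ) : ZMod p) = 0 := by push_cast; exact h
    rw [ZMod.intCast_zmod_eq_zero_iff_dvd] at h'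
    rcases hpi.dvd_or_dvd (show (p : ℤ) ∣ 2 * 2 from h') with h | h <;> exact hp2 h
  let Q : Polynomial (ZMod p) :=
    Polynomial.C 4 * Polynomial.X ^ 3 + Polynomial.C 0 * Polynomial.X ^ 2 +
      Polynomial.C 0 * Polynomial.X + Polynomial.C (-(b : ZMod p))
  have hdeg : Q.natDegree = 3 := Polynomial.natDegree_cubic h4
  have hQ0 : Q ≠ 0 := by
    intro h; rw [h] at hdeg; simp at hdeg
  have hcard : Q.roots.toFinset.card ≤ 3 :=
    (Multiset.toFinset_card_le _).trans (hdeg ▸ Polynomial.card_roots' Q)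
  calc _ ≤ ((Finset.range (N / p ^ 2 + 1)) ×ˢ Q.roots.toFinset).card := ?_
    _ ≤ _ := by
      rw [Finset.card_product, Finset.card_range, mul_comm]
      exact Nat.mul_le_mul_right _ hcard
  refine Finset.card_le_card_of_injOn
    (fun i => (i / p ^ 2, ((((m : ℤ) + W * i : ℤ)) : ZMod p))) ?_ ?_
  · intro i hi
    simp only [Finset.coe_filter, Set.mem_ofPred_eq, Finset.mem_range] at hi
    simp only [Finset.coe_product, Set.mem_prod, Finset.mem_coe, Finset.mem_range,
      Multiset.mem_toFinset]
    refine ⟨Nat.lt_succ_of_le (Nat.div_le_div_right hi.1.le), ?_⟩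
    rw [Polynomial.mem_roots hQ0, Polynomial.IsRoot.def]
    have h5 : ((4 * ((m : ℤ) + W * i) ^ 3 - b : ℤ) : ZMod p) = 0 := by
      rw [ZMod.intCast_zmod_eq_zero_iff_dvd]
      exact (dvd_pow_self _ two_ne_zero).trans hi.2
    push_cast at h5
    simp only [Q, Polynomial.eval_add, Polynomial.eval_mul, Polynomial.eval_C, Polynomial.eval_pow,
      Polynomial.eval_X]
    push_cast
    linear_combination h5
  · intro i hi i' hi' h
    simp only [Finset.coe_filter, Set.mem_ofPred_eq, Finset.mem_range] at hi hi'
    simp only [Prod.mk.injEq] at h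
    obtain ⟨e1, e2⟩ := h
    have hi2 := hi.2
    have hi2' := hi'.2
    rw [ZMod.intCast_eq_intCast_iff_dvd_sub] at e2
    set u : ℤ := (m : ℤ) + W * i with hu
    set v : ℤ := (m : ℤ) + W * i' with hv
    have hpu : ¬ (p : ℤ) ∣ u := by
      intro h
      apply hb
      have h6 : (p : ℤ) ∣ 4 * u ^ 3 := (h.trans (dvd_pow_self u three_ne_zero)).mul_left 4
      have := dvd_sub h6 ((dvd_pow_self _ two_ne_zero).trans hi2)
      exact this.trans (dvd_of_eq (by ring))
    have hcop : IsCoprime ((p : ℤ) ^ 2) (4 * (u ^ 2 + u * v + v ^ 2)) := by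
      apply IsCoprime.pow_left
      rw [hpi.coprime_iff_not_dvd]
      intro h
      have h7 : (p : ℤ) ∣ 2 * (2 * (3 * (u * u))) := by
        obtain ⟨w, hw⟩ := e2
        have h8 := dvd_sub h ((dvd_mul_right (p : ℤ) w).mul_right (4 * (2 * u + v)))
        refine h8.trans (dvd_of_eq ?_)
        rw [← hw]; ring
      rcases hpi.dvd_or_dvd h7 with h | h
      · exact hp2 h
      rcases hpi.dvd_or_dvd h with h | h
      · exact hp2 h
      rcases hpi.dvd_or_dvd h with h | h
      · exact hp3 h
      rcases hpi.dvd_or_dvd h with h | h <;> exact hpu h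
    have h9 : (p : ℤ) ^ 2 ∣ (4 * (u ^ 2 + u * v + v ^ 2)) * (v - u) :=
      (dvd_sub hi2' hi2).trans (dvd_of_eq (by ring))
    have h10 : (p : ℤ) ^ 2 ∣ W * ((i' : ℤ) - i) :=
      (hcop.dvd_of_dvd_mul_left h9).trans (dvd_of_eq (by rw [hu, hv]; ring))
    have hWc : IsCoprime ((p : ℤ) ^ 2) (W : ℤ) := by
      apply IsCoprime.pow_left
      rw [hpi.coprime_iff_not_dvd]
      intro h
      exact hW (by exact_mod_cast h)
    have h11 : i ≡ i' [MOD p ^ 2] := by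
      rw [Nat.modEq_iff_dvd]
      push_cast
      exact hWc.dvd_of_dvd_mul_left h10
    rw [← Nat.div_add_mod i (p ^ 2), ← Nat.div_add_mod i' (p ^ 2), e1, h11]

open scoped Classical in
theorem card_exists_sq_dvd_le {b : ℤ} {z : ℕ} (hz : 3 ≤ z) (hbz : b.natAbs ≤ z) (hb : b ≠ 0)
    {W : ℕ} (hW : ∀ p, p.Prime → p ∣ W → p ≤ z) (m N Y : ℕ) :
    ((((Finset.range N).filter (fun i : ℕ => ∃ p : ℕ, p.Prime ∧ z < p ∧ p ≤ Y ∧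
      ((p : ℤ) ^ 2 ∣ 4 * ((m : ℤ) + W * i) ^ 3 - b))).card : ℕ) : ℝ) ≤
        3 * N / z + 3 * Nat.primeCounting Y := by
  rcases lt_or_ge Y z with hYz | hYz
  · rw [Finset.filter_false_of_mem]
    · simp only [Finset.card_empty, Nat.cast_zero]; positivity
    · rintro i - ⟨p, -, h1, h2, -⟩
      omega
  let R := (Finset.Ioc z Y).filter Nat.Prime
  have hsub : (Finset.range N).filter (fun i : ℕ => ∃ p : ℕ, p.Prime ∧ z < p ∧ p ≤ Y ∧
      ((p : ℤ) ^ 2 ∣ 4 * ((m : ℤ) + W * i) ^ 3 - b)) ⊆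
      R.biUnion (fun p => (Finset.range N).filter
        (fun i : ℕ => ((p : ℤ) ^ 2 ∣ 4 * ((m : ℤ) + W * i) ^ 3 - b))) := by
    intro i hi
    obtain ⟨h1, p, h2, h3, h4, h5⟩ := Finset.mem_filter.1 hi
    refine Finset.mem_biUnion.2 ⟨p, ?_, Finset.mem_filter.2 ⟨h1, h5⟩⟩
    exact Finset.mem_filter.2 ⟨Finset.mem_Ioc.2 ⟨h3, h4⟩, h2⟩
  have h1 : ((Finset.range N).filter (fun i : ℕ => ∃ p : ℕ, p.Prime ∧ z < p ∧ p ≤ Y ∧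
      ((p : ℤ) ^ 2 ∣ 4 * ((m : ℤ) + W * i) ^ 3 - b))).card ≤
      ∑ p ∈ R, 3 * (N / p ^ 2 + 1) := by
    refine (Finset.card_le_card hsub).trans (Finset.card_biUnion_le.trans ?_)
    refine Finset.sum_le_sum fun p hp => ?_
    obtain ⟨h2, h3⟩ := Finset.mem_filter.1 hp
    have h4 := (Finset.mem_Ioc.1 h2).1
    refine card_sq_dvd_le h3 (by omega) (by omega) (fun h => ?_) (fun h => ?_) m N
    · have := Nat.le_of_dvd (Int.natAbs_pos.2 hb) (Int.natCast_dvd.1 h)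
      omega
    · have := hW p h3 h
      omega
  have hR : R.card ≤ Nat.primeCounting Y := by
    rw [← Nat.primesLE_card_eq_primeCounting]
    refine Finset.card_le_card fun p hp => ?_
    obtain ⟨h2, h3⟩ := Finset.mem_filter.1 hp
    rw [Nat.mem_primesLE]
    exact ⟨(Finset.mem_Ioc.1 h2).2, h3⟩
  have hsum : ∑ p ∈ R, ((p : ℝ) ^ 2)⁻¹ ≤ (z : ℝ)⁻¹ := by
    calc ∑ p ∈ R, ((p : ℝ) ^ 2)⁻¹ ≤ ∑ p ∈ Finset.Ioc z Y, ((p : ℝ) ^ 2)⁻¹ :=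
          Finset.sum_le_sum_of_subset_of_nonneg (Finset.filter_subset _ _)
            (fun _ _ _ => by positivity)
      _ ≤ (z : ℝ)⁻¹ - (Y : ℝ)⁻¹ := sum_Ioc_inv_sq_le_sub (by omega) hYz
      _ ≤ (z : ℝ)⁻¹ := sub_le_self _ (by positivity)
  calc _ ≤ ((∑ p ∈ R, 3 * (N / p ^ 2 + 1) : ℕ) : ℝ) := by exact_mod_cast h1
    _ = ∑ p ∈ R, 3 * (((N / p ^ 2 : ℕ) : ℝ) + 1) := by push_cast; rfl
    _ ≤ ∑ p ∈ R, (3 * N * ((p : ℝ) ^ 2)⁻¹ + 3) := by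
        refine Finset.sum_le_sum fun p _ => ?_
        have := @Nat.cast_div_le ℝ _ _ _ N (p ^ 2)
        push_cast at this
        rw [div_eq_mul_inv] at this
        linarith
    _ = 3 * N * ∑ p ∈ R, ((p : ℝ) ^ 2)⁻¹ + 3 * R.card := by
        rw [Finset.sum_add_distrib, ← Finset.mul_sum, Finset.sum_const, nsmul_eq_mul, mul_comm (3 : ℝ) R.card]
    _ ≤ 3 * N * (z : ℝ)⁻¹ + 3 * Nat.primeCounting Y := by
        have : (R.card : ℝ) ≤ Nat.primeCounting Y := by exact_mod_cast hR
        gcongr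
    _ = _ := by rw [div_eq_mul_inv]

theorem eventually_primeCounting_le_mul {ε : ℝ} (hε : 0 < ε) :
    ∀ᶠ N : ℕ in Filter.atTop, (Nat.primeCounting N : ℝ) ≤ ε * N := by
  have h1 := tendsto_natCast_atTop_atTop (R := ℝ) |>.eventually
    (Chebyshev.eventually_primeCounting_le (ε := 1) one_pos)
  have h2 : ∀ᶠ N : ℕ in Filter.atTop, (Real.log 4 + 1) / ε + 1 ≤ Real.log (N : ℝ) :=
    (Real.tendsto_log_atTop.comp (tendsto_natCast_atTop_atTop (R := ℝ))).eventually_ge_atTop _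
  filter_upwards [h1, h2] with N hN1 hN2
  rw [Nat.floor_natCast] at hN1
  refine hN1.trans ?_
  have h4 : 0 < Real.log 4 := Real.log_pos (by norm_num)
  have h5 : 0 < Real.log (N : ℝ) := lt_of_lt_of_le (by positivity) hN2
  rw [div_le_iff₀ h5]
  have h6 : (Real.log 4 + 1) / ε ≤ Real.log N := by linarith
  rw [div_le_iff₀ hε] at h6
  have h7 : (0 : ℝ) ≤ N := Nat.cast_nonneg N
  nlinarith

/-! ### Rarity of values that are a small squarefree number times a square. -/

open scoped Classical in
theorem card_squarefree_mul_sq_le {b : ℤ} (hb : Odd b) {ε : ℝ} (hε : 0 < ε) :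
    ∃ J : ℕ, ∀ X : ℕ, ((((Finset.range (X + 1)).filter (fun m : ℕ => ∃ (k : ℕ) (y : ℤ),
      Squarefree k ∧ k * 2 ^ J ≤ X ∧ 4 * (m : ℤ) ^ 3 - b = k * y ^ 2)).card : ℕ) : ℝ) ≤ ε * X := by
  obtain ⟨C, hC⟩ := exists_card_roots_le hb
  obtain ⟨s, hs, hs0, hsB⟩ := exists_summable_sieve_bound hb
  have htail : ∀ᶠ J in Filter.atTop, ∑' i, s (i + J) < ε / (C + 1) :=
    (tendsto_sum_nat_add s).eventually_lt_const (by positivity)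
  obtain ⟨J, hJ⟩ := htail.exists
  refine ⟨J, fun X => ?_⟩
  let Pairs : ℕ → Finset (ℕ × ℕ) := fun K =>
    ((Finset.range (K + 1)) ×ˢ (Finset.range (K + 1))).filter
      (fun p : ℕ × ℕ => Squarefree p.1 ∧ p.2 < p.1 ∧ (p.1 : ℤ) ∣ 4 * (p.2 : ℤ) ^ 3 - b)
  let T : ℕ → ℕ × ℕ → Finset ℕ := fun j p =>
    (Finset.range (2 ^ (j + 1))).filter (fun t : ℕ => ∃ y : ℤ,
        4 * ((p.2 : ℤ) + p.1 * t) ^ 3 - b = p.1 * y ^ 2)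
  have hsub : (Finset.range (X + 1)).filter (fun m : ℕ => ∃ (k : ℕ) (y : ℤ),
      Squarefree k ∧ k * 2 ^ J ≤ X ∧ 4 * (m : ℤ) ^ 3 - b = k * y ^ 2) ⊆
      (Finset.range (X + 1)).biUnion (fun i => (Pairs (X / 2 ^ (i + J))).biUnion (fun p =>
        (T (i + J) p).image (fun t => p.2 + p.1 * t))) := by
    intro m hm
    obtain ⟨hmX, k, y, hk, hkJ, hy⟩ := Finset.mem_filter.1 hm
    rw [Finset.mem_range] at hmX
    have hk0 : 0 < k := Nat.pos_of_ne_zero hk.ne_zero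
    have hq : 2 ^ J ≤ X / k := by
      rw [Nat.le_div_iff_mul_le hk0, mul_comm]; exact hkJ
    have hq0 : X / k ≠ 0 := by have := Nat.one_le_two_pow (n := J); omega
    have hJj : J ≤ Nat.log 2 (X / k) := Nat.le_log_of_pow_le (by norm_num) hq
    -- Dyadic splitting: `k ≤ X / 2 ^ j` and `m / k < 2 ^ (j + 1)`, while `k * 2 ^ J ≤ X` gives `j ≥
    -- J`.
    set j := Nat.log 2 (X / k) with hj
    have hj1 : 2 ^ j ≤ X / k := Nat.pow_log_le_self 2 hq0
    have hj2 : X / k < 2 ^ (j + 1) := Nat.lt_pow_succ_log_self (by norm_num) _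
    have hkj : k ≤ X / 2 ^ j := by
      rw [Nat.le_div_iff_mul_le (by positivity), mul_comm]
      exact (Nat.le_div_iff_mul_le hk0).1 hj1
    have hjX : j < X := by
      calc j < 2 ^ j := Nat.lt_two_pow_self
        _ ≤ X / k := hj1
        _ ≤ X := Nat.div_le_self _ _
    have hmk : ((m % k : ℕ) : ℤ) + k * ((m / k : ℕ) : ℤ) = m := by
      exact_mod_cast Nat.mod_add_div m k
    have hak : m % k < k := Nat.mod_lt _ hk0
    refine Finset.mem_biUnion.2 ⟨j - J, Finset.mem_range.2 (by omega), ?_⟩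
    rw [Nat.sub_add_cancel hJj]
    refine Finset.mem_biUnion.2 ⟨(k, m % k), ?_, ?_⟩
    · refine Finset.mem_filter.2 ⟨Finset.mem_product.2
        ⟨Finset.mem_range.2 (by simp only; omega), Finset.mem_range.2 (by simp only; omega)⟩,
        hk, hak, ?_⟩
      have h1 : (k : ℤ) ∣ 4 * (m : ℤ) ^ 3 - b := ⟨_, hy⟩
      have h2 : ((m % k : ℕ) : ℤ) = m - k * ((m / k : ℕ) : ℤ) := by linarith
      simp only
      rw [h2]
      generalize ((m / k : ℕ) : ℤ) = t
      have h3 := dvd_sub h1 (dvd_mul_right (k : ℤ)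
        (t * (4 * ((m : ℤ) ^ 2 + m * (m - k * t) + (m - k * t) ^ 2))))
      exact h3.trans (dvd_of_eq (by ring))
    · refine Finset.mem_image.2 ⟨m / k, Finset.mem_filter.2 ⟨Finset.mem_range.2 ?_, y, ?_⟩,
        Nat.mod_add_div m k⟩
      · exact lt_of_le_of_lt (Nat.div_le_div_right (by omega)) hj2
      · simp only
        rw [hmk]; exact hy
  have h1 := (Finset.card_le_card hsub).trans Finset.card_biUnion_le
  have hterm : ∀ i, ((((Pairs (X / 2 ^ (i + J))).biUnion (fun p =>
        (T (i + J) p).image (fun t => p.2 + p.1 * t))).card : ℕ) : ℝ) ≤ C * X * s (i + J) := by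
    intro i
    have h2 : ∀ p ∈ Pairs (X / 2 ^ (i + J)), ((((T (i + J) p).image
        (fun t => p.2 + p.1 * t)).card : ℕ) : ℝ) ≤ s (i + J) * 2 ^ (i + J) := by
      intro p hp
      obtain ⟨-, hsq, -, hdvd⟩ := Finset.mem_filter.1 hp
      refine le_trans ?_ (hsB (i + J) p.1 p.2 (Nat.pos_of_ne_zero hsq.ne_zero) hdvd)
      exact_mod_cast Finset.card_image_le
    have h3 : (((Pairs (X / 2 ^ (i + J))).card : ℕ) : ℝ) ≤ C * (X / 2 ^ (i + J)) := by
      have h4 : (((Pairs (X / 2 ^ (i + J))).card : ℕ) : ℝ) ≤ C * ((X / 2 ^ (i + J) : ℕ) : ℝ) := by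
        exact_mod_cast (hC (X / 2 ^ (i + J)))
      refine h4.trans ?_
      have := @Nat.cast_div_le ℝ _ _ _ X (2 ^ (i + J))
      push_cast at this ⊢
      gcongr
    calc _ ≤ ((∑ p ∈ Pairs (X / 2 ^ (i + J)), ((T (i + J) p).image
        (fun t => p.2 + p.1 * t)).card : ℕ) : ℝ) := by exact_mod_cast Finset.card_biUnion_le
      _ ≤ (Pairs (X / 2 ^ (i + J))).card * (s (i + J) * 2 ^ (i + J)) := by
        rw [Nat.cast_sum, ← nsmul_eq_mul]
        exact Finset.sum_le_card_nsmul _ _ _ h2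
      _ ≤ C * (X / 2 ^ (i + J)) * (s (i + J) * 2 ^ (i + J)) := by
        have := hs0 (i + J)
        gcongr
      _ = C * X * s (i + J) := by field_simp
  calc _ ≤ ((∑ i ∈ Finset.range (X + 1), ((Pairs (X / 2 ^ (i + J))).biUnion (fun p =>
        (T (i + J) p).image (fun t => p.2 + p.1 * t))).card : ℕ) : ℝ) := by exact_mod_cast h1
    _ ≤ ∑ i ∈ Finset.range (X + 1), C * X * s (i + J) := by
        rw [Nat.cast_sum]; exact Finset.sum_le_sum fun i _ => hterm i
    _ = C * X * ∑ i ∈ Finset.range (X + 1), s (i + J) := by rw [Finset.mul_sum]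
    _ ≤ C * X * (ε / (C + 1)) := by
        gcongr
        exact (((summable_nat_add_iff J).2 hs).sum_le_tsum _ fun i _ => hs0 _).trans hJ.le
    _ = (C / (C + 1)) * (ε * X) := by field_simp
    _ ≤ 1 * (ε * X) := by
        gcongr
        rw [div_le_one (by positivity)]
        linarith
    _ = ε * X := one_mul _

/-! ### The final sieve and the discriminants. -/

/-- Take `m` divisible by exactly those primes up to `z` that do not divide `b`. Then each prime up
to `z` divides exactly one of `m` and `b`; the prime 2 divides `m`, so the coefficient 4 does no
harm. -/
theorem exists_base_point {b : ℤ} (hb : Odd b) (z G : ℕ) : ∃ m : ℕ, G ≤ m ∧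
    ∀ p : ℕ, p.Prime → p ≤ z → ¬ (p : ℤ) ∣ 4 * (m : ℤ) ^ 3 - b := by
  let Q := (Finset.range (z + 1)).filter (fun p : ℕ => p.Prime ∧ ¬ (p : ℤ) ∣ b)
  have hb2 : ¬ (2 : ℤ) ∣ b := fun h => Int.not_even_iff_odd.2 hb (even_iff_two_dvd.2 h)
  have hmod : ∀ p : ℕ, p.Prime → p ≤ z → ∀ i : ℕ,
      ¬ (p : ℤ) ∣ 4 * (((∏ q ∈ Q, q) + primorial z * i : ℕ) : ℤ) ^ 3 - b := by
    intro p hp hpz i h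
    have hpi : Prime (p : ℤ) := Nat.prime_iff_prime_int.1 hp
    have hpW : p ∣ primorial z * i :=
      (Finset.dvd_prod_of_mem _ (by simp [hp, hpz])).mul_right i
    by_cases hpb : (p : ℤ) ∣ b
    · have h1 : (p : ℤ) ∣ 2 * (2 * (((∏ q ∈ Q, q) + primorial z * i : ℕ) : ℤ) ^ 3) := by
        have := dvd_add h hpb
        exact this.trans (dvd_of_eq (by ring))
      have hp2 : ¬ (p : ℤ) ∣ 2 := by
        intro h2
        have := (Nat.prime_dvd_prime_iff_eq hp Nat.prime_two).1 (by exact_mod_cast h2)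
        subst this
        exact hb2 hpb
      have h2 := hpi.dvd_of_dvd_pow ((hpi.dvd_or_dvd
        ((hpi.dvd_or_dvd h1).resolve_left hp2)).resolve_left hp2)
      rw [Int.natCast_dvd_natCast] at h2
      have h3 : p ∣ ∏ q ∈ Q, q := (Nat.dvd_add_left hpW).1 h2
      obtain ⟨q, hq, hpq⟩ := (hp.prime.dvd_finsetProd_iff _).1 h3
      obtain ⟨-, hqp, hqb⟩ := Finset.mem_filter.1 hq
      rw [(Nat.prime_dvd_prime_iff_eq hp hqp).1 hpq] at hpb
      exact hqb hpb
    · apply hpb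
      have h1 : p ∣ (∏ q ∈ Q, q) + primorial z * i := by
        refine dvd_add (Finset.dvd_prod_of_mem _ ?_) hpW
        exact Finset.mem_filter.2 ⟨Finset.mem_range.2 (by omega), hp, hpb⟩
      have h2 : (p : ℤ) ∣ (((∏ q ∈ Q, q) + primorial z * i : ℕ) : ℤ) := by exact_mod_cast h1
      have h3 := dvd_sub ((h2.trans (dvd_pow_self _ three_ne_zero)).mul_left 4) h
      exact h3.trans (dvd_of_eq (by ring))
  refine ⟨(∏ q ∈ Q, q) + primorial z * G, ?_, fun p hp hpz => hmod p hp hpz G⟩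
  have := Nat.mul_le_mul_right G (primorial_pos z)
  omega

theorem not_dvd_of_modulus_dvd {b : ℤ} {p W m : ℕ} (hpW : p ∣ W)
    (h : ¬ (p : ℤ) ∣ 4 * (m : ℤ) ^ 3 - b) (i : ℕ) :
    ¬ (p : ℤ) ∣ 4 * ((m : ℤ) + W * i) ^ 3 - b := by
  intro h1
  apply h
  have h2 : (p : ℤ) ∣ W := by exact_mod_cast hpW
  have h3 := dvd_sub h1 (h2.mul_right
    (4 * (3 * (m : ℤ) ^ 2 * i + 3 * m * W * (i : ℤ) ^ 2 + (W : ℤ) ^ 2 * (i : ℤ) ^ 3)))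
  exact h3.trans (dvd_of_eq (by ring))

/-- If all primes whose square divides `4 * m ^ 3 - b` are large, then `4 * m ^ 3 - b` is a small
squarefree number times a square. -/
theorem exists_squarefree_mul_sq {b : ℤ} {m X J p : ℕ} (hm : b.natAbs < m) (hmX : m ≤ X)
    (hpd : (p : ℤ) ^ 2 ∣ 4 * (m : ℤ) ^ 3 - b)
    (hall : ∀ q : ℕ, q.Prime → (q : ℤ) ^ 2 ∣ 4 * (m : ℤ) ^ 3 - b → 2 ^ (J + 2) * X < q)
    (hp : p.Prime) :
    ∃ (k : ℕ) (y : ℤ), Squarefree k ∧ k * 2 ^ J ≤ X ∧ 4 * (m : ℤ) ^ 3 - b = k * y ^ 2 := by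
  have hX0 : 0 < X := by omega
  have hb1 : |b| < m := by rw [Int.abs_eq_natAbs]; exact_mod_cast hm
  have hm1 : (1 : ℤ) ≤ m := by have := abs_nonneg b; omega
  have hmm : (m : ℤ) ≤ (m : ℤ) ^ 3 := le_self_pow₀ hm1 (by norm_num)
  have hpos : 0 < 4 * (m : ℤ) ^ 3 - b := by have := le_abs_self b; linarith
  have hle : 4 * (m : ℤ) ^ 3 - b ≤ 5 * (X : ℤ) ^ 3 := by
    have h1 : (m : ℤ) ^ 3 ≤ (X : ℤ) ^ 3 := by gcongr
    have := neg_abs_le b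
    linarith
  obtain ⟨k, hk⟩ := hpd
  have hp0 : (0 : ℤ) < (p : ℤ) ^ 2 := by have := hp.pos; positivity
  have hk0 : 0 < k := by
    rw [hk] at hpos
    exact pos_of_mul_pos_right hpos hp0.le
  lift k to ℕ using hk0.le
  have hpl : 2 ^ (J + 2) * X < p := hall p hp ⟨k, hk⟩
  -- Otherwise `k * p ^ 2` would be at least `16 * X ^ 3`, beyond the bound `5 * X ^ 3`.
  have hkX : k * 2 ^ J ≤ X := by
    by_contra hlt
    have h1 : (X : ℤ) < k * 2 ^ J := by exact_mod_cast not_le.1 hlt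
    have h2 : ((2 : ℤ) ^ (J + 2) * X) ^ 2 ≤ (p : ℤ) ^ 2 := by
      have : ((2 : ℤ) ^ (J + 2) * X) ≤ p := by exact_mod_cast hpl.le
      gcongr
    have h3 : (X : ℤ) * (16 * X ^ 2) ≤ k * 2 ^ J * (16 * X ^ 2) := by gcongr
    have h4 : (k : ℤ) * 2 ^ J * (16 * X ^ 2) ≤ k * (2 ^ J * 2 ^ J) * (16 * X ^ 2) := by
      have : (1 : ℤ) ≤ 2 ^ J := one_le_pow₀ (by norm_num)
      have h5 : (2 : ℤ) ^ J * 1 ≤ 2 ^ J * 2 ^ J := by gcongr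
      rw [mul_one] at h5
      gcongr
    have h5 : (k : ℤ) * ((2 : ℤ) ^ (J + 2) * X) ^ 2 ≤ k * (p : ℤ) ^ 2 := by gcongr
    have h6 : (k : ℤ) * ((2 : ℤ) ^ (J + 2) * X) ^ 2 = k * (2 ^ J * 2 ^ J) * (16 * X ^ 2) := by ring
    have h7 : (0 : ℤ) < (X : ℤ) ^ 3 := by positivity
    have h8 : (X : ℤ) * (16 * X ^ 2) = 16 * X ^ 3 := by ring
    rw [hk, mul_comm] at hle
    linarith
  refine ⟨k, p, ?_, hkX, by rw [hk, mul_comm]⟩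
  rw [Nat.squarefree_iff_prime_squarefree]
  intro q hq hqk
  have h1 : (q : ℤ) ^ 2 ∣ 4 * (m : ℤ) ^ 3 - b := by
    rw [hk, sq (q : ℤ)]
    exact Dvd.dvd.mul_left (by exact_mod_cast hqk) _
  have h2 := hall q hq h1
  have h3 : q * q ≤ k := Nat.le_of_dvd (by exact_mod_cast hk0) hqk
  have h4 : q ≤ q * q := Nat.le_mul_self q
  have h5 : k ≤ k * 2 ^ J := Nat.le_mul_of_pos_right k (by positivity)
  have h6 : X ≤ 2 ^ (J + 2) * X := Nat.le_mul_of_pos_left X (by positivity)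
  omega

theorem exists_squarefree_cubic {b : ℤ} (hb : Odd b) (G : ℕ) :
    ∃ m : ℕ, G ≤ m ∧ b.natAbs < m ∧ Squarefree (4 * (m : ℤ) ^ 3 - b) := by
  classical
  have hb0 : 0 < b.natAbs := (Int.natAbs_odd.2 hb).pos
  -- The constants make the exceptional sets at most `N/16 + N/8` (medium primes) and `N/4` (large
  -- primes), using `X ≤ 2 * W * N`; the total stays below `N`.
  set z : ℕ := 48 * b.natAbs with hz
  set W : ℕ := primorial z with hW
  have hW0 : 0 < W := primorial_pos z
  have hW0' : (0 : ℝ) < W := by exact_mod_cast hW0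
  obtain ⟨m₀, hm₀, hbase⟩ := exists_base_point hb z (G + b.natAbs + 1)
  obtain ⟨J, hJ⟩ := card_squarefree_mul_sq_le hb (ε := 1 / (8 * W)) (by positivity)
  set H : ℕ := 2 ^ (J + 2) with hH
  have hH0 : 0 < H := by positivity
  have hH0' : (0 : ℝ) < H := by exact_mod_cast hH0
  obtain ⟨N₀, hN₀⟩ := Filter.eventually_atTop.1
    (eventually_primeCounting_le_mul (ε := 1 / (48 * H * W)) (by positivity))
  set N := max N₀ m₀ with hN
  have hNm : m₀ ≤ N := le_max_right _ _
  have hN0 : 0 < N := by omega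
  set X := m₀ + W * N with hX
  have hXN : N ≤ X := by have := Nat.mul_le_mul_right N hW0; omega
  have hX2 : X ≤ 2 * W * N := by have := Nat.mul_le_mul_right N hW0; nlinarith
  have hX2' : (X : ℝ) ≤ 2 * W * N := by exact_mod_cast hX2
  have hpi : (Nat.primeCounting (H * X) : ℝ) ≤ N / 24 := by
    have h1 : N₀ ≤ H * X :=
      ((le_max_left _ _).trans hXN).trans (Nat.le_mul_of_pos_left X hH0)
    refine (hN₀ _ h1).trans ?_
    push_cast
    calc 1 / (48 * (H : ℝ) * W) * (H * X) ≤ 1 / (48 * (H : ℝ) * W) * (H * (2 * W * N)) := by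
          gcongr
      _ = N / 24 := by field_simp; norm_num
  set A := (Finset.range N).filter (fun i : ℕ => ∃ p : ℕ, p.Prime ∧ z < p ∧ p ≤ H * X ∧
      ((p : ℤ) ^ 2 ∣ 4 * ((m₀ : ℤ) + W * i) ^ 3 - b)) with hA
  set B := (Finset.range (X + 1)).filter (fun m : ℕ => ∃ (k : ℕ) (y : ℤ),
      Squarefree k ∧ k * 2 ^ J ≤ X ∧ 4 * (m : ℤ) ^ 3 - b = k * y ^ 2) with hB
  set B' := (Finset.range N).filter (fun i : ℕ => m₀ + W * i ∈ B) with hB'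
  have hAcard : (A.card : ℝ) ≤ 3 * N / z + 3 * Nat.primeCounting (H * X) := by
    refine card_exists_sq_dvd_le (by omega) (by omega) (by omega) (fun p hp hpW => ?_) m₀ N _
    obtain ⟨q, hq, hpq⟩ := (hp.prime.dvd_finsetProd_iff _).1 hpW
    have hq' : q ≤ z ∧ q.Prime := by simpa [Nat.mem_primesLE] using hq
    rw [(Nat.prime_dvd_prime_iff_eq hp hq'.2).1 hpq]
    exact hq'.1
  have hB'card : (B'.card : ℝ) ≤ N / 4 := by
    have h1 : B'.card ≤ B.card := by
      refine Finset.card_le_card_of_injOn (fun i => m₀ + W * i)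
        (fun i hi => (Finset.mem_filter.1 hi).2) (fun i _ i' _ h => ?_)
      exact Nat.eq_of_mul_eq_mul_left hW0 (Nat.add_left_cancel h)
    calc (B'.card : ℝ) ≤ B.card := by exact_mod_cast h1
      _ ≤ 1 / (8 * W) * X := hJ X
      _ ≤ 1 / (8 * W) * (2 * W * N) := by gcongr
      _ = N / 4 := by field_simp; norm_num
  have hN0' : (0 : ℝ) < N := by exact_mod_cast hN0
  have hAz : 3 * (N : ℝ) / z ≤ N / 16 := by
    have h48 : (48 : ℝ) ≤ z := by exact_mod_cast (by omega : 48 ≤ z)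
    rw [div_le_div_iff₀ (by linarith) (by norm_num)]
    nlinarith
  have hlt : (A ∪ B').card < (Finset.range N).card := by
    rw [Finset.card_range]
    have h1 : ((A ∪ B').card : ℝ) ≤ A.card + B'.card := by exact_mod_cast Finset.card_union_le _ _
    have h2 : ((A ∪ B').card : ℝ) < N := by linarith
    exact_mod_cast h2
  obtain ⟨i, hi, hiAB⟩ := Finset.exists_mem_notMem_of_card_lt_card hlt
  rw [Finset.mem_union, not_or] at hiAB
  refine ⟨m₀ + W * i, by omega, by omega, ?_⟩
  by_contra hns
  rw [← Int.squarefree_natAbs, Nat.squarefree_iff_prime_squarefree] at hns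
  push Not at hns
  obtain ⟨p, hp, hpd⟩ := hns
  have hiN := Finset.mem_range.1 hi
  have hpd' : (p : ℤ) ^ 2 ∣ 4 * (((m₀ + W * i : ℕ)) : ℤ) ^ 3 - b := by
    rw [sq]; exact_mod_cast Int.natCast_dvd.2 hpd
  have hall : ∀ q : ℕ, q.Prime → (q : ℤ) ^ 2 ∣ 4 * (((m₀ + W * i : ℕ)) : ℤ) ^ 3 - b →
      2 ^ (J + 2) * X < q := by
    intro q hq hqd
    push_cast at hqd
    by_contra hle
    apply hiAB.1
    refine Finset.mem_filter.2 ⟨hi, q, hq, ?_, not_lt.1 hle, hqd⟩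
    by_contra hqz
    have hqW : q ∣ W := Finset.dvd_prod_of_mem _ (by simp [hq, not_lt.1 hqz])
    exact not_dvd_of_modulus_dvd hqW (hbase q hq (not_lt.1 hqz)) i
      ((dvd_pow_self _ two_ne_zero).trans hqd)
  have hmX : m₀ + W * i ≤ X := Nat.add_le_add_left (Nat.mul_le_mul_left W hiN.le) m₀
  apply hiAB.2
  refine Finset.mem_filter.2 ⟨hi, Finset.mem_filter.2 ⟨Finset.mem_range.2 (by omega), ?_⟩⟩
  exact exists_squarefree_mul_sq (by omega) hmX hpd' hall hp

theorem exists_squarefree_cubicDisc {n : ℤ} (hn : Odd n) (G : ℕ) :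
    ∃ m : ℕ, G ≤ m ∧ Squarefree (cubicDisc m n) ∧ IsFundamentalDiscriminant (cubicDisc m n) ∧
      (m : ℤ) ≤ cubicDisc m n := by
  have hb : Odd (27 * n ^ 2) := Odd.mul (by decide) hn.pow
  obtain ⟨m, hmG, hm, hsq⟩ := exists_squarefree_cubic hb (G + 2)
  have hb1 : |27 * n ^ 2| < (m : ℤ) := by rw [Int.abs_eq_natAbs]; exact_mod_cast hm
  have hm2 : (2 : ℤ) ≤ m := by exact_mod_cast (by omega : 2 ≤ m)
  have hmm : (m : ℤ) ≤ (m : ℤ) ^ 3 := le_self_pow₀ (by omega) (by norm_num)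
  have hle : (m : ℤ) ≤ cubicDisc m n := by
    have := le_abs_self (27 * n ^ 2)
    unfold cubicDisc
    linarith
  -- The discriminant is at least `m ≥ 2`, hence not 1; this is why `G + 2` was requested.
  refine ⟨m, by omega, hsq, Or.inl ⟨?_, hsq, by omega⟩, hle⟩
  obtain ⟨r, rfl⟩ := hn
  have h : cubicDisc m (2 * r + 1) = 4 * ((m : ℤ) ^ 3 - 27 * r ^ 2 - 27 * r - 7) + 1 := by
    unfold cubicDisc; ring
  omega

theorem mainTheorem7 :
    (∀ n : ℤ, Odd n →
      {m : ℤ | Squarefree (cubicDisc m n)}.Infinite ∧ (squarefreeDiscriminantsOf n).Infinite) ∧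
    squarefreeDiscriminants.Infinite := by
  have key : ∀ n : ℤ, Odd n → (squarefreeDiscriminantsOf n).Infinite := by
    intro n hn
    refine Set.infinite_of_not_bddAbove ?_
    rintro ⟨M, hM⟩
    obtain ⟨m, hmG, hsq, hfd, hle⟩ := exists_squarefree_cubicDisc hn (M.toNat + 1)
    have := hM (show cubicDisc m n ∈ squarefreeDiscriminantsOf n from ⟨hsq, hfd, m, rfl⟩)
    omega
  refine ⟨fun n hn => ⟨?_, key n hn⟩, ?_⟩
  · refine Set.infinite_of_not_bddAbove ?_
    rintro ⟨M, hM⟩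
    obtain ⟨m, hmG, hsq, -, -⟩ := exists_squarefree_cubicDisc hn (M.toNat + 1)
    have := hM (show (m : ℤ) ∈ {m : ℤ | Squarefree (cubicDisc m n)} from hsq)
    omega
  · refine (key 1 odd_one).mono ?_
    rintro D ⟨h1, h2, m, h3⟩
    exact ⟨h1, h2, m, 1, h3⟩
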